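/- Let $C(0)$ be the set of functions $\gamma:\mathbb C\to\mathbb C$ with $\lim_{t\to0}\gamma(t)=\gamma(0)=0$ and $|\gamma(t)|\ge|t|$ whenever $|t|\le1$. For $n\in\mathbb N$ and $a>0$ let $\mathscr D_a$ be the space of smooth functions $\xi:\mathbb R^n\to\mathbb C$ that vanish outside $\{|x|\le a\}$, with the topology of uniform convergence of all derivatives; let $\mathscr D=\bigcup_{m\ge1}\mathscr D_m$ with its locally convex inductive limit topology, and let $\mathscr S$ be the space of rapidly decreasing smooth functions $\mathbb R^n\to\mathbb C$ with its usual topology. Let $E$ be one of $\mathscr D_a,\mathscr D,\mathscr S$ and let $\mathcal N(E)$ be the family of neighborhoods of $0$ in $E$. For $\gamma\in C(0)$ and $U\in\mathcal N(E)$ let $E^{(\gamma,U)}$ be the set of continuous functions $f:E\to\mathbb C$ such that $f(0)=0$ and for all $\xi\in E$, $\eta\in U$ and $t\in\mathbb C$ with $|t|\le1$ there are $r,s\in\mathbb C$ with $|r-1|\le|\gamma(t)|$, $|s|\le|\gamma(t)|$ and $f(\xi+t\eta)=rf(\xi)+sf(\eta)$. Let $E^{[\gamma,U]}$ be the set of continuous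 $f:E\to\mathbb C$ such that $f(0)=0$ and for all such $\xi,\eta,t$ there is $s\in\mathbb C$ with $|s|\le|\gamma(t)|$ and $f(\xi+t\eta)=f(\xi)+sf(\eta)$. The elements of these sets are called demi-distributions. Let $\mathcal F$ be one of the sets $E^{(\gamma,U)}$, $E^{[\gamma,U]}$. A sequence $(f_k)$ in $\mathcal F$ is called $w*$-Cauchy if $\lim_k f_k(\xi)$ exists for every $\xi\in E$. The set $\mathcal F$ is called sequentially complete if for every $w*$-Cauchy sequence $(f_k)$ in $\mathcal F$ there is $f\in\mathcal F$ such that, for every bounded $B\subset E$, $f_k(\xi)\to f(\xi)$ uniformly for $\xi\in B$. **Theorem.** For every $\gamma\in C(0)$, $a>0$, $U\in\mathcal N(\mathscr D_a)$ and $V\in\mathcal N(\mathscr S)$, both $\mathscr D_a^{(\gamma,U)}$ and $\mathscr S^{(\gamma,V)}$ are sequentially complete. Moreover, $\mathscr D^{[\gamma_0,W]}$ is sequentially complete for $\gamma_0(t)=t$ and every $W\in\mathcal N(\mathscr D)$. -/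

import Mathlib

open Set Filter Topology

namespace DemiDist

section General

/-- The class `C(0)` of functions `γ : ℂ → ℂ` with `lim_{t → 0} γ(t) = γ(0) = 0` and
`|γ(t)| ≥ |t|` for `|t| ≤ 1`. -/
def C0 : Set (ℂ → ℂ) :=
  {γ | γ 0 = 0 ∧ Tendsto γ (𝓝 0) (𝓝 0) ∧ ∀ t : ℂ, ‖t‖ ≤ 1 → ‖t‖ ≤ ‖γ t‖}

/-- The family `𝓛_{γ,U}(X,Y)` of demi-linear mappings related to `γ` and `U`: `f(0) = 0`, and for
all `x ∈ X`, `u ∈ U`, `|t| ≤ 1` there are scalars `r, s` with `|r - 1| ≤ |γ(t)|`, `|s| ≤ |γ(t)|`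
and `f(x + tu) = r f(x) + s f(u)`. -/
def demiLinear {X Y : Type*} [AddCommGroup X] [Module ℂ X] [AddCommGroup Y] [Module ℂ Y]
    (γ : ℂ → ℂ) (U : Set X) : Set (X → Y) :=
  {f | f 0 = 0 ∧ ∀ x : X, ∀ u ∈ U, ∀ t : ℂ, ‖t‖ ≤ 1 →
    ∃ r s : ℂ, ‖r - 1‖ ≤ ‖γ t‖ ∧ ‖s‖ ≤ ‖γ t‖ ∧ f (x + t • u) = r • f x + s • f u}

/-- The family `𝓚_{γ,U}(X,Y)`: the demi-linear mappings for which one can take `r = 1`, that is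
`f(x + tu) = f(x) + s f(u)` with `|s| ≤ |γ(t)|`. -/
def strongDemiLinear {X Y : Type*} [AddCommGroup X] [Module ℂ X] [AddCommGroup Y] [Module ℂ Y]
    (γ : ℂ → ℂ) (U : Set X) : Set (X → Y) :=
  {f | f 0 = 0 ∧ ∀ x : X, ∀ u ∈ U, ∀ t : ℂ, ‖t‖ ≤ 1 →
    ∃ s : ℂ, ‖s‖ ≤ ‖γ t‖ ∧ f (x + t • u) = f x + s • f u}

/-- `E^{(γ,U)}`: the demi-distributions on `E` related to `γ` and `U`, i.e. the continuous
functionals in `𝓛_{γ,U}(E,ℂ)`. -/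
def demiDistributions {E : Type*} [AddCommGroup E] [Module ℂ E] [TopologicalSpace E]
    (γ : ℂ → ℂ) (U : Set E) : Set (E → ℂ) :=
  {f | Continuous f ∧ f ∈ demiLinear γ U}

/-- `E^{[γ,U]}`: the continuous functionals in `𝓚_{γ,U}(E,ℂ)`. -/
def strongDemiDistributions {E : Type*} [AddCommGroup E] [Module ℂ E] [TopologicalSpace E]
    (γ : ℂ → ℂ) (U : Set E) : Set (E → ℂ) :=
  {f | Continuous f ∧ f ∈ strongDemiLinear γ U}

/-- A sequence of functionals is `w*` Cauchy if it has a limit at every point. -/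
def IsWeakStarCauchy {E : Type*} (f : ℕ → E → ℂ) : Prop :=
  ∀ ξ : E, ∃ z : ℂ, Tendsto (fun k => f k ξ) atTop (𝓝 z)

/-- A family `𝓕` of functionals on `E` is sequentially complete if every `w*` Cauchy sequence
in `𝓕` converges to some member of `𝓕`, uniformly on every bounded subset of `E`. -/
def IsSeqComplete {E : Type*} [AddCommGroup E] [Module ℂ E] [TopologicalSpace E]
    (𝓕 : Set (E → ℂ)) : Prop :=
  ∀ f : ℕ → E → ℂ, (∀ k, f k ∈ 𝓕) → IsWeakStarCauchy f →
    ∃ g ∈ 𝓕, ∀ B : Set E, Bornology.IsVonNBounded ℂ B → TendstoUniformlyOn f g atTop B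

end General

section TestSpaces

/-- The compact ball `{x ∈ ℝⁿ : |x| ≤ a}`. -/
def closedBallCompacts (n : ℕ) (a : ℝ) : TopologicalSpace.Compacts (EuclideanSpace ℝ (Fin n)) :=
  ⟨Metric.closedBall 0 a, isCompact_closedBall 0 a⟩

/-- `𝓓_a`: the smooth functions `ℝⁿ → ℂ` vanishing outside `{|x| ≤ a}`, with the topology of
uniform convergence of all derivatives (here the order `⊤ : ℕ∞` means `C^∞`). -/
abbrev TestBall (n : ℕ) (a : ℝ) : Type :=
  ContDiffMapSupportedIn (EuclideanSpace ℝ (Fin n)) ℂ (⊤ : ℕ∞) (closedBallCompacts n a)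

/-- `𝓓`: the smooth compactly supported functions `ℝⁿ → ℂ`, with the locally convex inductive
limit topology of the spaces of functions supported in a fixed compact set. -/
abbrev TestSpace (n : ℕ) : Type :=
  TestFunction (⊤ : TopologicalSpace.Opens (EuclideanSpace ℝ (Fin n))) ℂ (⊤ : ℕ∞)

/-- `𝓢`: the rapidly decreasing smooth functions `ℝⁿ → ℂ`, with the usual seminorms. -/
abbrev RapidSpace (n : ℕ) : Type :=
  SchwartzMap (EuclideanSpace ℝ (Fin n)) ℂ

end TestSpaces

end DemiDist

/-!
A scalar-valued map `f` is demi-linear precisely when `f 0 = 0` and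
`‖f (x + t • u) - f x‖ ≤ ‖γ t‖ * (‖f x‖ + ‖f u‖)` for `u ∈ U`, `‖t‖ ≤ 1`
(`mem_demiLinear_iff`); with `r = 1` the right-hand side is `‖γ t‖ * ‖f u‖`. These conditions pass to
pointwise limits. If moreover a pointwise convergent sequence `f k` is bounded, uniformly in `k`, on
a neighborhood `V` of `0`, the inequality with `u ∈ V` and `γ t → 0` shows that the sequence is
equicontinuous. So its limit is continuous, and the convergence is uniform on totally bounded sets
(`continuous_of_tendsto_of_norm_le`, `tendstoUniformlyOn_of_norm_le`). It remains to find `V`, and to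
prove the Montel property that bounded sets are totally bounded.

On a Baire space `V` comes from the category theorem: the `f k` are uniformly bounded near some
point `x`, and demi-linearity transports the bound from `x` to `0` in finitely many small steps
(`exists_nhds_norm_le_of_baire`). The Schwartz space is complete because uniform limits commute with
derivatives, and it has the Montel property by a compactness argument on finite nets of large balls
(`totallyBounded_of_isVonNBounded_schwartzMap`). The space `𝓓_K` of smooth functions vanishing
outside a compact set `K` inherits both properties, as it embeds in the Schwartz space with closed
range.

The space `𝓓` of all test functions is not a Baire space in general. When `r = 1` and `γ t = t`, however, the
functions `‖f k ·‖` are convex on a convex neighborhood of `0`, hence so is the set where they are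
all at most `1`. A convex set is a neighborhood of `0` in the inductive limit as soon as its trace on
each `𝓓_K` is one (`convex_mem_nhds_zero`), and the traces are handled by the Baire case. The Montel
property of `𝓓` follows from that of the Schwartz space since a bounded set of test functions is
supported in a single ball (`exists_forall_notMem_closedBall_eq_zero_of_isVonNBounded`).
-/

namespace DemiDist

/-! ### Demi-linear functionals: pointwise limits and equicontinuity -/

theorem exists_mul_eq_of_norm_le {c : ℝ} {a b : ℂ} (hc : 0 ≤ c) (h : ‖a‖ ≤ c * ‖b‖) :
    ∃ s : ℂ, ‖s‖ ≤ c ∧ a = s * b := by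
  rcases eq_or_ne b 0 with rfl | hb
  · exact ⟨0, by simpa using hc, by simpa using h⟩
  · have hb' : 0 < ‖b‖ := norm_pos_iff.2 hb
    exact ⟨a / b, by rw [norm_div]; exact (div_le_iff₀ hb').2 h, by field_simp⟩

theorem exists_mul_add_mul_eq_of_norm_le {c : ℝ} {z a b : ℂ} (hc : 0 ≤ c)
    (h : ‖z‖ ≤ c * (‖a‖ + ‖b‖)) :
    ∃ r s : ℂ, ‖r‖ ≤ c ∧ ‖s‖ ≤ c ∧ z = r * a + s * b := by
  -- write `z = w * (|a| + |b|)` with `|w| ≤ c` and absorb the phases of `a` and `b` into `r`, `s`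
  obtain ⟨w, hw, hz⟩ := exists_mul_eq_of_norm_le (a := z) (b := ((‖a‖ + ‖b‖ : ℝ) : ℂ)) hc
    (by rwa [Complex.norm_real, Real.norm_of_nonneg (by positivity)])
  obtain ⟨r, hr, hra⟩ := exists_mul_eq_of_norm_le (a := w * (‖a‖ : ℂ)) (b := a) hc (by
    rw [norm_mul, Complex.norm_real, norm_norm]; gcongr)
  obtain ⟨s, hs, hsb⟩ := exists_mul_eq_of_norm_le (a := w * (‖b‖ : ℂ)) (b := b) hc (by
    rw [norm_mul, Complex.norm_real, norm_norm]; gcongr)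
  refine ⟨r, s, hr, hs, ?_⟩
  rw [hz, ← hra, ← hsb]
  push_cast
  ring

section Algebra

variable {E : Type*} [AddCommGroup E] [Module ℂ E] {γ : ℂ → ℂ} {U : Set E} {f : E → ℂ}

/-- For scalar-valued maps, demi-linearity is a norm inequality between values of `f`, hence a
pointwise closed condition. -/
theorem mem_demiLinear_iff : f ∈ demiLinear γ U ↔ f 0 = 0 ∧ ∀ x, ∀ u ∈ U, ∀ t : ℂ, ‖t‖ ≤ 1 →
    ‖f (x + t • u) - f x‖ ≤ ‖γ t‖ * (‖f x‖ + ‖f u‖) := by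
  refine and_congr_right fun _ => forall₅_congr fun x u hu t ht => ⟨?_, fun h => ?_⟩
  · rintro ⟨r, s, hr, hs, h⟩
    have : f (x + t • u) - f x = (r - 1) * f x + s * f u := by
      rw [h, smul_eq_mul, smul_eq_mul]; ring
    calc ‖f (x + t • u) - f x‖ ≤ ‖r - 1‖ * ‖f x‖ + ‖s‖ * ‖f u‖ := by
          rw [this, ← norm_mul, ← norm_mul]; exact norm_add_le _ _
      _ ≤ ‖γ t‖ * ‖f x‖ + ‖γ t‖ * ‖f u‖ := by gcongr
      _ = _ := by ring
  · obtain ⟨r, s, hr, hs, h⟩ := exists_mul_add_mul_eq_of_norm_le (norm_nonneg _) h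
    refine ⟨r + 1, s, by simpa using hr, hs, ?_⟩
    rw [smul_eq_mul, smul_eq_mul]
    linear_combination h

theorem mem_strongDemiLinear_iff : f ∈ strongDemiLinear γ U ↔ f 0 = 0 ∧ ∀ x, ∀ u ∈ U, ∀ t : ℂ,
    ‖t‖ ≤ 1 → ‖f (x + t • u) - f x‖ ≤ ‖γ t‖ * ‖f u‖ := by
  refine and_congr_right fun _ => forall₅_congr fun x u hu t ht => ⟨?_, fun h => ?_⟩
  · rintro ⟨s, hs, h⟩
    rw [h, add_sub_cancel_left, norm_smul]
    gcongr
  · obtain ⟨s, hs, h⟩ := exists_mul_eq_of_norm_le (norm_nonneg _) h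
    exact ⟨s, hs, by rw [smul_eq_mul]; linear_combination h⟩

theorem strongDemiLinear_subset_demiLinear :
    (strongDemiLinear γ U : Set (E → ℂ)) ⊆ demiLinear γ U := by
  intro f hf
  rw [mem_strongDemiLinear_iff] at hf
  rw [mem_demiLinear_iff]
  refine ⟨hf.1, fun x u hu t ht => (hf.2 x u hu t ht).trans ?_⟩
  gcongr
  exact le_add_of_nonneg_left (norm_nonneg _)

theorem mem_demiLinear_of_tendsto {f : ℕ → E → ℂ} {g : E → ℂ} (hf : ∀ k, f k ∈ demiLinear γ U)
    (hg : ∀ x, Tendsto (fun k => f k x) atTop (𝓝 (g x))) : g ∈ demiLinear γ U := by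
  simp only [mem_demiLinear_iff] at hf ⊢
  refine ⟨tendsto_nhds_unique (hg 0) (by simp [(hf _).1]), fun x u hu t ht => ?_⟩
  exact le_of_tendsto_of_tendsto' ((hg _).sub (hg x)).norm
    (((hg x).norm.add (hg u).norm).const_mul _) fun k => (hf k).2 x u hu t ht

theorem mem_strongDemiLinear_of_tendsto {f : ℕ → E → ℂ} {g : E → ℂ}
    (hf : ∀ k, f k ∈ strongDemiLinear γ U)
    (hg : ∀ x, Tendsto (fun k => f k x) atTop (𝓝 (g x))) : g ∈ strongDemiLinear γ U := by
  simp only [mem_strongDemiLinear_iff] at hf ⊢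
  refine ⟨tendsto_nhds_unique (hg 0) (by simp [(hf _).1]), fun x u hu t ht => ?_⟩
  exact le_of_tendsto_of_tendsto' ((hg _).sub (hg x)).norm
    ((hg u).norm.const_mul _) fun k => (hf k).2 x u hu t ht

/-- Translation by a multiple `-m • w` of some `w` with `-w ∈ U` preserves uniform bounds. -/
theorem exists_norm_sub_nsmul_le {f : ℕ → E → ℂ} (hf : ∀ k, f k ∈ demiLinear γ U) {w : E}
    (hw : -w ∈ U) {A : ℝ} (hA : ∀ k, ‖f k (-w)‖ ≤ A) (M : ℝ) (m : ℕ) :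
    ∃ M' : ℝ, ∀ k x, ‖f k x‖ ≤ M → ‖f k (x - m • w)‖ ≤ M' := by
  induction m with
  | zero => exact ⟨M, fun k x hx => by simpa using hx⟩
  | succ m ih =>
    obtain ⟨M', hM'⟩ := ih
    refine ⟨M' + ‖γ 1‖ * (M' + A), fun k x hx => ?_⟩
    have h := (mem_demiLinear_iff.1 (hf k)).2 (x - m • w) (-w) hw 1 (by simp)
    have h1 : x - (m + 1) • w = (x - m • w) + (1 : ℂ) • (-w) := by
      rw [one_smul, succ_nsmul]; abel
    have h2 := norm_le_insert' (f k (x - (m + 1) • w)) (f k (x - m • w))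
    rw [← h1] at h
    refine h2.trans (add_le_add (hM' k x hx) (h.trans ?_))
    gcongr
    exacts [hM' k x hx, hA k]

end Algebra

section Core

theorem exists_norm_le_of_isWeakStarCauchy {E : Type*} {f : ℕ → E → ℂ}
    (hf : IsWeakStarCauchy f) (x : E) :
    ∃ C : ℝ, ∀ k, ‖f k x‖ ≤ C := by
  obtain ⟨z, hz⟩ := hf x
  obtain ⟨C, hC⟩ := hz.norm.bddAbove_range
  exact ⟨C, fun k => hC ⟨k, rfl⟩⟩

variable {E : Type*} [AddCommGroup E] [Module ℂ E]
  {γ : ℂ → ℂ} {U : Set E} {f : ℕ → E → ℂ}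

theorem exists_norm_lt_of_mem_C0 (hγ : γ ∈ C0) {δ : ℝ} (hδ : 0 < δ) :
    ∃ t : ℂ, t ≠ 0 ∧ ‖t‖ ≤ 1 ∧ ‖γ t‖ < δ := by
  obtain ⟨ε, hε, h⟩ := Metric.tendsto_nhds_nhds.1 hγ.2.1 δ hδ
  refine ⟨((min (ε / 2) 1 : ℝ) : ℂ), ?_, ?_, ?_⟩
  · exact_mod_cast (by positivity : (0 : ℝ) < min (ε / 2) 1).ne'
  · rw [Complex.norm_real, Real.norm_of_nonneg (by positivity)]
    exact min_le_right _ _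
  · rw [← dist_zero_right]
    refine h ?_
    rw [dist_zero_right, Complex.norm_real, Real.norm_of_nonneg (by positivity)]
    exact (min_le_left _ _).trans_lt (by linarith)

/-- Baire category argument: a pointwise bounded sequence of continuous demi-linear functionals is
bounded, uniformly in the index, on a neighborhood of `0`. -/
theorem exists_nhds_norm_le_of_baire [TopologicalSpace E] [IsTopologicalAddGroup E]
    [ContinuousSMul ℂ E] [BaireSpace E]
    (hU : U ∈ 𝓝 0) (hf : ∀ k, f k ∈ demiLinear γ U) (hfc : ∀ k, Continuous (f k))
    (hb : ∀ x, ∃ C : ℝ, ∀ k, ‖f k x‖ ≤ C) :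
    ∃ V ∈ 𝓝 (0 : E), ∃ M : ℝ, ∀ k, ∀ u ∈ V, ‖f k u‖ ≤ M := by
  obtain ⟨m, x, hx⟩ := nonempty_interior_of_iUnion_of_closed
    (f := fun m : ℕ => {x : E | ∀ k, ‖f k x‖ ≤ m})
    (fun m => by
      simp only [ofPred_forall]
      exact isClosed_iInter fun k => isClosed_le (hfc k).norm continuous_const)
    (by
      refine eq_univ_of_forall fun x => mem_iUnion.2 ?_
      obtain ⟨C, hC⟩ := hb x
      obtain ⟨m, hm⟩ := exists_nat_ge C
      exact ⟨m, fun k => (hC k).trans hm⟩)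
  rw [mem_interior_iff_mem_nhds] at hx
  -- the interior point `x` is moved back to `0` in finitely many steps of size `x / N`
  have hlim : Tendsto (fun N : ℕ => -(((N : ℂ) + 1)⁻¹ • x)) atTop (𝓝 0) := by
    have h0 : Tendsto (fun N : ℕ => ((N : ℂ) + 1)⁻¹) atTop (𝓝 0) := by
      simpa only [one_div] using tendsto_one_div_add_atTop_nhds_zero_nat (𝕜 := ℂ)
    simpa using (h0.smul_const x).neg
  obtain ⟨N, hN⟩ := (hlim.eventually_mem hU).exists
  set w := ((N : ℂ) + 1)⁻¹ • x with hw
  have hxw : (N + 1) • w = x := by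
    rw [hw, ← Nat.cast_smul_eq_nsmul ℂ, smul_smul]
    push_cast
    rw [mul_inv_cancel₀ (Nat.cast_add_one_ne_zero N), one_smul]
  obtain ⟨A, hA⟩ := hb (-w)
  obtain ⟨M', hM'⟩ := exists_norm_sub_nsmul_le hf hN hA m (N + 1)
  have ht : Tendsto (fun u : E => u + x) (𝓝 0) (𝓝 x) := by
    have : Continuous fun u : E => u + x := by fun_prop
    simpa using this.tendsto 0
  refine ⟨_, ht hx, M', fun k u hu => ?_⟩
  have := hM' k (u + x) (hu k)
  rwa [hxw, add_sub_cancel_right] at this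

/-- A sequence of demi-linear functionals which is bounded uniformly on a neighborhood `V` of `0`
satisfies a Lipschitz type estimate in the directions of `V`. -/
theorem norm_sub_le_of_norm_le {V : Set E} {M : ℝ} (hf : ∀ k, f k ∈ demiLinear γ U)
    (hVU : V ⊆ U) (hM : ∀ k, ∀ u ∈ V, ‖f k u‖ ≤ M) {t : ℂ} (ht : ‖t‖ ≤ 1) (k : ℕ) (x : E)
    {u : E} (hu : u ∈ V) : ‖f k (x + t • u) - f k x‖ ≤ ‖γ t‖ * (‖f k x‖ + M) := by
  refine ((mem_demiLinear_iff.1 (hf k)).2 x u (hVU hu) t ht).trans ?_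
  gcongr
  exact hM k u hu

theorem exists_smul_mem_nhds [TopologicalSpace E] [IsTopologicalAddGroup E]
    [ContinuousConstSMul ℂ E] {V : Set E} (hV : V ∈ 𝓝 0) {t : ℂ} (ht : t ≠ 0) (x : E) :
    ∀ᶠ y in 𝓝 x, ∃ u ∈ V, y = x + t • u := by
  have h : Tendsto (fun y : E => t⁻¹ • (y - x)) (𝓝 x) (𝓝 0) := by
    have : Continuous fun y : E => t⁻¹ • (y - x) := by fun_prop
    simpa using this.tendsto x
  filter_upwards [h hV] with y hy
  exact ⟨_, hy, by rw [smul_inv_smul₀ ht]; abel⟩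

/-- The pointwise limit of a sequence of demi-linear functionals that are uniformly bounded on a
neighborhood of `0` is continuous, by equicontinuity. -/
theorem continuous_of_tendsto_of_norm_le [TopologicalSpace E] [IsTopologicalAddGroup E]
    [ContinuousConstSMul ℂ E] (hγ : γ ∈ C0) (hU : U ∈ 𝓝 0) (hf : ∀ k, f k ∈ demiLinear γ U)
    {V : Set E} (hV : V ∈ 𝓝 0) {M : ℝ} (hM : ∀ k, ∀ u ∈ V, ‖f k u‖ ≤ M) {g : E → ℂ}
    (hg : ∀ x, Tendsto (fun k => f k x) atTop (𝓝 (g x))) : Continuous g := by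
  rw [continuous_iff_continuousAt]
  intro x
  refine Metric.tendsto_nhds.2 fun ε hε => ?_
  have hM0 : 0 ≤ M := (norm_nonneg _).trans (hM 0 0 (mem_of_mem_nhds hV))
  obtain ⟨t, ht0, ht1, ht⟩ := exists_norm_lt_of_mem_C0 hγ
    (by positivity : 0 < ε / (‖g x‖ + M + 1))
  filter_upwards [exists_smul_mem_nhds (inter_mem hV hU) ht0 x]
  rintro _ ⟨u, hu, rfl⟩
  have h1 : ‖g (x + t • u) - g x‖ ≤ ‖γ t‖ * (‖g x‖ + M) :=
    le_of_tendsto_of_tendsto' ((hg _).sub (hg x)).norm (((hg x).norm.add_const M).const_mul _)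
      fun k => norm_sub_le_of_norm_le hf inter_subset_right (fun k u hu => hM k u hu.1) ht1 k x hu
  rw [dist_eq_norm]
  refine h1.trans_lt ?_
  rw [lt_div_iff₀ (by positivity)] at ht
  nlinarith [norm_nonneg (γ t)]

/-- A pointwise convergent sequence of demi-linear functionals that are uniformly bounded on a
neighborhood of `0` converges uniformly on totally bounded sets. -/
theorem tendstoUniformlyOn_of_norm_le [UniformSpace E] [IsUniformAddGroup E]
    [ContinuousConstSMul ℂ E] (hγ : γ ∈ C0) (hU : U ∈ 𝓝 0) (hf : ∀ k, f k ∈ demiLinear γ U)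
    {V : Set E} (hV : V ∈ 𝓝 0) {M : ℝ} (hM : ∀ k, ∀ u ∈ V, ‖f k u‖ ≤ M) {g : E → ℂ}
    (hg : ∀ x, Tendsto (fun k => f k x) atTop (𝓝 (g x))) {B : Set E} (hB : TotallyBounded B) :
    TendstoUniformlyOn f g atTop B := by
  have hM0 : 0 ≤ M := (norm_nonneg _).trans (hM 0 0 (mem_of_mem_nhds hV))
  have key : ∀ t : ℂ, ‖t‖ ≤ 1 → ∀ k x, ∀ u ∈ V ∩ U,
      ‖f k (x + t • u) - f k x‖ ≤ ‖γ t‖ * (‖f k x‖ + M) := fun t ht k x u hu =>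
    norm_sub_le_of_norm_le hf inter_subset_right (fun k u hu => hM k u hu.1) ht k x hu
  have net : ∀ t : ℂ, t ≠ 0 → ∃ F ⊆ B, F.Finite ∧
      ∀ x ∈ B, ∃ y ∈ F, ∃ u ∈ V ∩ U, x = y + t • u := by
    intro t ht
    have hd : {p : E × E | t⁻¹ • (p.1 - p.2) ∈ V ∩ U} ∈ uniformity E := by
      rw [uniformity_eq_comap_nhds_zero_swapped]
      refine ⟨(fun z : E => t⁻¹ • z) ⁻¹' (V ∩ U), ?_, fun p hp => hp⟩
      have : Continuous fun z : E => t⁻¹ • z := by fun_prop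
      exact this.tendsto' 0 0 (smul_zero _) (inter_mem hV hU)
    obtain ⟨F, hFB, hF, hc⟩ := totallyBounded_iff_subset.1 hB _ hd
    refine ⟨F, hFB, hF, fun x hx => ?_⟩
    obtain ⟨y, hy, hxy⟩ := mem_iUnion₂.1 (hc hx)
    exact ⟨y, hy, _, hxy, by rw [smul_inv_smul₀ ht]; abel⟩
  have hcau : IsWeakStarCauchy f := fun x => ⟨_, hg x⟩
  -- uniform boundedness on `B`, from a net of step `t = 1`
  obtain ⟨C, hC⟩ : ∃ C : ℝ, ∀ k, ∀ x ∈ B, ‖f k x‖ ≤ C := by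
    obtain ⟨F, -, hF, hc⟩ := net 1 one_ne_zero
    choose A hA using exists_norm_le_of_isWeakStarCauchy hcau
    obtain ⟨A', hA'⟩ := (hF.image A).bddAbove
    refine ⟨A' + ‖γ 1‖ * (A' + M), fun k x hx => ?_⟩
    obtain ⟨y, hy, u, hu, rfl⟩ := hc x hx
    have hy' : ‖f k y‖ ≤ A' := (hA y k).trans (hA' ⟨y, hy, rfl⟩)
    have h2 := norm_le_insert' (f k (y + (1 : ℂ) • u)) (f k y)
    refine h2.trans (add_le_add hy' ((key 1 (by simp) k y u hu).trans ?_))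
    gcongr
  rw [Metric.tendstoUniformlyOn_iff]
  intro ε hε
  obtain ⟨t, ht0, ht1, ht⟩ := exists_norm_lt_of_mem_C0 hγ
    (by positivity : 0 < ε / 4 / (|C| + M + 1))
  rw [lt_div_iff₀ (by positivity)] at ht
  obtain ⟨F, hFB, hF, hc⟩ := net t ht0
  have hev : ∀ᶠ k in atTop, ∀ y ∈ F, dist (f k y) (g y) < ε / 4 :=
    (hF.eventually_all).2 fun y _ => Metric.tendsto_nhds.1 (hg y) _ (by positivity)
  filter_upwards [hev] with k hk x hx
  obtain ⟨y, hy, u, hu, rfl⟩ := hc x hx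
  have h1 : ∀ j, ‖f j (y + t • u) - f j y‖ ≤ ε / 4 := fun j => by
    have h2 : ‖f j y‖ ≤ |C| := (hC j y (hFB hy)).trans (le_abs_self C)
    have h3 := key t ht1 j y u hu
    nlinarith [norm_nonneg (γ t)]
  have h2 : ‖g (y + t • u) - g y‖ ≤ ε / 4 :=
    le_of_tendsto' ((hg _).sub (hg y)).norm h1
  have h3 := h1 k
  have h4 := hk y hy
  rw [← dist_eq_norm] at h2 h3
  calc dist (g (y + t • u)) (f k (y + t • u))
      ≤ dist (g (y + t • u)) (g y) + dist (g y) (f k y) + dist (f k y) (f k (y + t • u)) :=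
        dist_triangle4 _ _ _ _
    _ < ε := by rw [dist_comm (g y), dist_comm (f k y) (f k _)]; linarith

/-- Sequential completeness in Baire spaces whose bounded sets are totally bounded. -/
theorem isSeqComplete_demiDistributions [UniformSpace E] [IsUniformAddGroup E]
    [ContinuousSMul ℂ E] [BaireSpace E]
    (hE : ∀ B : Set E, Bornology.IsVonNBounded ℂ B → TotallyBounded B)
    (hγ : γ ∈ C0) (hU : U ∈ 𝓝 0) : IsSeqComplete (demiDistributions γ U) := by
  intro f hf hcau
  choose g hg using hcau
  have hfd : ∀ k, f k ∈ demiLinear γ U := fun k => (hf k).2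
  obtain ⟨V, hV, M, hM⟩ := exists_nhds_norm_le_of_baire hU hfd (fun k => (hf k).1)
    (exists_norm_le_of_isWeakStarCauchy fun x => ⟨_, hg x⟩)
  exact ⟨g, ⟨continuous_of_tendsto_of_norm_le hγ hU hfd hV hM hg,
    mem_demiLinear_of_tendsto hfd hg⟩, fun B hB =>
    tendstoUniformlyOn_of_norm_le hγ hU hfd hV hM hg (hE B hB)⟩

end Core

/-! ### Completeness and the Montel property of the Schwartz space -/

section Seminorms

variable {𝕜 E ι : Type*} [NormedField 𝕜] [AddCommGroup E] [Module 𝕜 E] [UniformSpace E]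
  [IsUniformAddGroup E] {p : SeminormFamily 𝕜 E ι}

theorem cauchy_iff_seminorm [Nonempty ι] (hp : WithSeminorms p) {l : Filter E} [l.NeBot] :
    Cauchy l ↔ ∀ i, ∀ ε > 0, ∃ A ∈ l, ∀ x ∈ A, ∀ y ∈ A, p i (x - y) < ε := by
  rw [p.withSeminorms_iff_uniformSpace_eq_iInf.1 hp, cauchy_iInf_uniformSpace]
  refine forall_congr' fun i => ?_
  let := (p i).toSeminormedAddCommGroup
  rw [Metric.cauchy_iff]
  simp only [dist_eq_norm]
  exact and_iff_right ‹_›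

theorem cauchySeq_iff_seminorm [Nonempty ι] (hp : WithSeminorms p) {u : ℕ → E} :
    CauchySeq u ↔ ∀ i, ∀ ε > 0, ∃ N, ∀ m ≥ N, ∀ k ≥ N, p i (u m - u k) < ε := by
  rw [CauchySeq, cauchy_iff_seminorm hp]
  refine forall₃_congr fun i ε _ => ⟨?_, ?_⟩
  · rintro ⟨A, hA, h⟩
    obtain ⟨N, hN⟩ := mem_atTop_sets.1 hA
    exact ⟨N, fun m hm k hk => h _ (hN m hm) _ (hN k hk)⟩
  · rintro ⟨N, h⟩
    refine ⟨u '' Ici N, image_mem_map (Ici_mem_atTop N), ?_⟩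
    rintro _ ⟨m, hm, rfl⟩ _ ⟨k, hk, rfl⟩
    exact h m hm k hk

end Seminorms

section Derivatives

variable {E F : Type*} [NormedAddCommGroup E] [NormedSpace ℝ E] [NormedAddCommGroup F]
  [NormedSpace ℝ F]

theorem hasFDerivAt_iteratedFDeriv {f : E → F} (hf : ContDiff ℝ (⊤ : ℕ∞) f) (i : ℕ) (x : E) :
    HasFDerivAt (iteratedFDeriv ℝ i f) (iteratedFDeriv ℝ (i + 1) f x).curryLeft x := by
  have h := (hf.differentiable_iteratedFDeriv (m := i)
    (by exact_mod_cast ENat.natCast_lt_top i) x).hasFDerivAt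
  rwa [fderiv_iteratedFDeriv] at h

/-- If all derivatives of a sequence of smooth functions are uniformly Cauchy, then the sequence
converges, with all its derivatives, to a smooth function. -/
theorem exists_contDiff_tendsto_iteratedFDeriv [CompleteSpace F] {f : ℕ → E → F}
    (hf : ∀ m, ContDiff ℝ (⊤ : ℕ∞) (f m))
    (h : ∀ i, UniformCauchySeqOn (fun m => iteratedFDeriv ℝ i (f m)) atTop univ) :
    ∃ g : E → F, ContDiff ℝ (⊤ : ℕ∞) g ∧ ∀ i x,
      Tendsto (fun m => iteratedFDeriv ℝ i (f m) x) atTop (𝓝 (iteratedFDeriv ℝ i g x)) := by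
  have hG : ∀ (x : E) (i : ℕ), ∃ z, Tendsto (fun m => iteratedFDeriv ℝ i (f m) x) atTop (𝓝 z) :=
    fun x i => cauchySeq_tendsto_of_complete ((h i).cauchySeq (mem_univ x))
  choose G hG using hG
  have hGu : ∀ i, TendstoUniformly (fun m => iteratedFDeriv ℝ i (f m)) (fun x => G x i) atTop :=
    fun i => tendstoUniformlyOn_univ.1
      ((h i).tendstoUniformlyOn_of_tendsto fun x _ => hG x i)
  have hT : HasFTaylorSeriesUpTo (⊤ : ℕ∞) (fun x => (G x 0).curry0) G := by
    refine (hasFTaylorSeriesUpTo_top_iff' le_rfl).2 ⟨fun x => rfl, fun i x => ?_⟩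
    refine hasFDerivAt_of_tendstoUniformly
      (f' := fun m y => (iteratedFDeriv ℝ (i + 1) (f m) y).curryLeft)
      (g' := fun y => (G y (i + 1)).curryLeft) ?_
      (fun m y => hasFDerivAt_iteratedFDeriv (hf m) i y) (fun y => hG y i) x
    exact (continuousMultilinearCurryLeftEquiv ℝ (fun _ : Fin (i + 1) => E)
      F).isometry.uniformContinuous.comp_tendstoUniformly (hGu (i + 1))
  refine ⟨_, hT.contDiff, fun i x => ?_⟩
  rw [← hT.eq_iteratedFDeriv (by exact_mod_cast le_top) x]
  exact hG x i

end Derivatives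

section Schwartz

open SchwartzMap

variable {E F : Type*} [NormedAddCommGroup E] [NormedSpace ℝ E] [NormedAddCommGroup F]
  [NormedSpace ℝ F]

theorem iteratedFDeriv_schwartz_sub (f g : 𝓢(E, F)) (i : ℕ) (x : E) :
    iteratedFDeriv ℝ i (f - g) x = iteratedFDeriv ℝ i f x - iteratedFDeriv ℝ i g x := by
  have h : (⇑(f - g) : E → F) = ⇑f - ⇑g := by ext; simp
  rw [h]
  exact iteratedFDeriv_sub_apply (f.smooth i).contDiffAt (g.smooth i).contDiffAt

theorem le_seminorm_sub (k i : ℕ) (f g : 𝓢(E, F)) (x : E) :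
    ‖x‖ ^ k * ‖iteratedFDeriv ℝ i f x - iteratedFDeriv ℝ i g x‖ ≤
      SchwartzMap.seminorm ℝ k i (f - g) := by
  rw [← iteratedFDeriv_schwartz_sub]
  exact SchwartzMap.le_seminorm ℝ k i (f - g) x

instance completeSpace_schwartzMap [CompleteSpace F] : CompleteSpace 𝓢(E, F) := by
  have := IsUniformAddGroup.uniformity_countably_generated (α := 𝓢(E, F))
  refine UniformSpace.complete_of_cauchySeq_tendsto fun u hu => ?_
  have hs := schwartz_withSeminorms ℝ E F
  rw [cauchySeq_iff_seminorm hs] at hu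
  obtain ⟨g, hg, hlim⟩ := exists_contDiff_tendsto_iteratedFDeriv (fun m => (u m).smooth ⊤)
    (fun i => by
      rw [Metric.uniformCauchySeqOn_iff]
      intro ε hε
      obtain ⟨N, hN⟩ := hu (0, i) ε hε
      refine ⟨N, fun m hm k hk x _ => ?_⟩
      rw [dist_eq_norm]
      refine lt_of_le_of_lt ?_ (hN m hm k hk)
      simpa using le_seminorm_sub 0 i (u m) (u k) x)
  have key : ∀ k i : ℕ, ∀ ε > 0, ∃ N, ∀ m ≥ N, ∀ x,
      ‖x‖ ^ k * ‖iteratedFDeriv ℝ i (u m) x - iteratedFDeriv ℝ i g x‖ ≤ ε := by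
    intro k i ε hε
    obtain ⟨N, hN⟩ := hu (k, i) ε hε
    refine ⟨N, fun m hm x => ?_⟩
    refine le_of_tendsto (((hlim i x).const_sub _).norm.const_mul _)
      ((eventually_ge_atTop N).mono fun j hj => ?_)
    exact (le_seminorm_sub k i (u m) (u j) x).trans (hN m hm j hj).le
  let G : 𝓢(E, F) := ⟨g, hg, fun k i => by
    obtain ⟨N, hN⟩ := key k i 1 one_pos
    refine ⟨SchwartzMap.seminorm ℝ k i (u N) + 1, fun x => ?_⟩
    have h1 := hN N le_rfl x
    have h2 := SchwartzMap.le_seminorm ℝ k i (u N) x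
    have h3 := norm_le_insert (iteratedFDeriv ℝ i (u N) x) (iteratedFDeriv ℝ i g x)
    calc ‖x‖ ^ k * ‖iteratedFDeriv ℝ i g x‖
        ≤ ‖x‖ ^ k * (‖iteratedFDeriv ℝ i (u N) x‖ +
          ‖iteratedFDeriv ℝ i (u N) x - iteratedFDeriv ℝ i g x‖) := by gcongr
      _ ≤ _ := by rw [mul_add]; exact add_le_add h2 h1⟩
  refine ⟨G, (hs.tendsto_nhds_atTop u G).2 fun ⟨k, i⟩ ε hε => ?_⟩
  obtain ⟨N, hN⟩ := key k i (ε / 2) (half_pos hε)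
  refine ⟨N, fun m hm => lt_of_le_of_lt ?_ (half_lt_self hε)⟩
  refine SchwartzMap.seminorm_le_bound ℝ k i _ (half_pos hε).le fun x => ?_
  rw [iteratedFDeriv_schwartz_sub]
  exact hN m hm x

theorem baireSpace_schwartzMap [CompleteSpace F] : BaireSpace 𝓢(E, F) := by
  have := IsUniformAddGroup.uniformity_countably_generated (α := 𝓢(E, F))
  let := UniformSpace.pseudoMetricSpace 𝓢(E, F)
  infer_instance

theorem norm_iteratedFDeriv_sub_le {f : E → F} (hf : ContDiff ℝ (⊤ : ℕ∞) f) {i : ℕ} {C : ℝ}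
    (hC : ∀ x, ‖iteratedFDeriv ℝ (i + 1) f x‖ ≤ C) (x y : E) :
    ‖iteratedFDeriv ℝ i f x - iteratedFDeriv ℝ i f y‖ ≤ C * ‖x - y‖ :=
  convex_univ.norm_image_sub_le_of_norm_hasFDerivWithin_le
    (fun z _ => (hasFDerivAt_iteratedFDeriv hf i z).hasFDerivWithinAt)
    (fun z _ => by
      rw [ContinuousMultilinearMap.curryLeft_norm]
      exact hC z) (mem_univ y) (mem_univ x)

/-- The Montel property of the Schwartz space. Along an ultrafilter on a bounded set, the
derivatives of order `i` converge at the points of a finite net of a large ball; the derivatives of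
order `i + 1` control them between these points, and the decay controls them outside the ball. -/
theorem totallyBounded_of_isVonNBounded_schwartzMap {𝕜 : Type*} [NontriviallyNormedField 𝕜]
    [NormedSpace 𝕜 F] [SMulCommClass ℝ 𝕜 F] [FiniteDimensional ℝ E] [FiniteDimensional ℝ F]
    {B : Set 𝓢(E, F)} (hB : Bornology.IsVonNBounded 𝕜 B) : TotallyBounded B := by
  have hbd : ∀ k i : ℕ, ∃ C > 0, ∀ f ∈ B, ∀ x, ‖x‖ ^ k * ‖iteratedFDeriv ℝ i f x‖ ≤ C := by
    intro k i
    obtain ⟨C, hC0, hC⟩ :=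
      ((schwartz_withSeminorms 𝕜 E F).isVonNBounded_iff_seminorm_bounded.1 hB) (k, i)
    exact ⟨C, hC0, fun f hf x => (SchwartzMap.le_seminorm 𝕜 k i f x).trans (hC f hf).le⟩
  rw [totallyBounded_iff_ultrafilter]
  intro l hl
  rw [cauchy_iff_seminorm (schwartz_withSeminorms ℝ E F)]
  rintro ⟨k, i⟩ ε hε
  obtain ⟨C₁, hC₁, h₁⟩ := hbd (k + 1) i
  obtain ⟨C₂, hC₂, h₂⟩ := hbd 0 (i + 1)
  obtain ⟨C₀, hC₀, h₀⟩ := hbd 0 i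
  simp only [pow_zero, one_mul] at h₂ h₀
  set R : ℝ := 8 * C₁ / ε with hR
  have hR0 : 0 < R := by positivity
  set δ : ℝ := ε / (8 * R ^ k * C₂) with hδ
  have hδ0 : 0 < δ := by positivity
  have : ProperSpace E := FiniteDimensional.proper ℝ E
  obtain ⟨T, hT, hcov⟩ := Metric.totallyBounded_iff.1
    (isCompact_closedBall (0 : E) R).totallyBounded δ hδ0
  have hpt : ∀ y : E, ∃ A ∈ l, ∀ f ∈ A, ∀ g ∈ A,
      ‖iteratedFDeriv ℝ i f y - iteratedFDeriv ℝ i g y‖ < ε / (4 * R ^ k) := by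
    intro y
    have : FiniteDimensional ℝ (E [×i]→L[ℝ] F) := FiniteDimensional.of_injective
      (ContinuousMultilinearMap.toMultilinearMapLinear : (E [×i]→L[ℝ] F) →ₗ[ℝ] _)
      ContinuousMultilinearMap.toMultilinearMap_injective
    have : ProperSpace (E [×i]→L[ℝ] F) := FiniteDimensional.proper ℝ _
    have hc := (isCompact_closedBall (0 : E [×i]→L[ℝ] F) C₀).ultrafilter_le_nhds
      (l.map fun f : 𝓢(E, F) => iteratedFDeriv ℝ i f y) (by
        rw [Ultrafilter.coe_map, Filter.le_principal_iff, Filter.mem_map]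
        filter_upwards [Filter.le_principal_iff.1 hl] with f hf
        simpa using h₀ f hf y)
    obtain ⟨z, -, hz⟩ := hc
    obtain ⟨A, hA, h⟩ := (Metric.cauchy_iff.1 (cauchy_nhds.mono hz)).2 (ε / (4 * R ^ k))
      (by positivity)
    refine ⟨_, hA, fun f hf g hg => ?_⟩
    rw [← dist_eq_norm]
    exact h _ hf _ hg
  choose A hA hAd using hpt
  refine ⟨B ∩ ⋂ y ∈ T, A y, inter_mem (Filter.le_principal_iff.1 hl)
    ((Filter.biInter_mem hT).2 fun y _ => hA y), fun f hf g hg => ?_⟩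
  refine lt_of_le_of_lt ?_ (half_lt_self hε)
  refine SchwartzMap.seminorm_le_bound ℝ k i _ (half_pos hε).le fun x => ?_
  rw [iteratedFDeriv_schwartz_sub]
  rcases le_or_gt ‖x‖ R with hx | hx
  · obtain ⟨y, hy, hxy⟩ := mem_iUnion₂.1 (hcov (mem_closedBall_zero_iff.2 hx))
    rw [Metric.mem_ball, dist_eq_norm] at hxy
    have e1 := norm_iteratedFDeriv_sub_le (f.smooth ⊤) (h₂ f hf.1) x y
    have e2 := norm_iteratedFDeriv_sub_le (g.smooth ⊤) (h₂ g hg.1) x y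
    have e3 := hAd y f (mem_iInter₂.1 hf.2 y hy) g (mem_iInter₂.1 hg.2 y hy)
    have e4 : C₂ * ‖x - y‖ ≤ ε / (8 * R ^ k) := by
      calc C₂ * ‖x - y‖ ≤ C₂ * δ := by gcongr
        _ = ε / (8 * R ^ k) := by rw [hδ]; field_simp
    have e5 : ‖iteratedFDeriv ℝ i f x - iteratedFDeriv ℝ i g x‖ ≤ ε / (2 * R ^ k) := by
      calc ‖iteratedFDeriv ℝ i f x - iteratedFDeriv ℝ i g x‖
          = ‖(iteratedFDeriv ℝ i f x - iteratedFDeriv ℝ i f y) +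
              (iteratedFDeriv ℝ i f y - iteratedFDeriv ℝ i g y) -
              (iteratedFDeriv ℝ i g x - iteratedFDeriv ℝ i g y)‖ := by congr 1; abel
        _ ≤ ε / (8 * R ^ k) + ε / (4 * R ^ k) + ε / (8 * R ^ k) :=
            (norm_sub_le _ _).trans (add_le_add ((norm_add_le _ _).trans
              (add_le_add (e1.trans e4) e3.le)) (e2.trans e4))
        _ = ε / (2 * R ^ k) := by field_simp; norm_num
    calc ‖x‖ ^ k * ‖iteratedFDeriv ℝ i f x - iteratedFDeriv ℝ i g x‖
        ≤ R ^ k * (ε / (2 * R ^ k)) := by gcongr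
      _ = ε / 2 := by field_simp
  · have e : ∀ f ∈ B, ‖x‖ ^ k * ‖iteratedFDeriv ℝ i f x‖ ≤ ε / 8 := fun f hf => by
      have h3 := h₁ f hf x
      have hx0 : 0 < ‖x‖ := hR0.trans hx
      rw [pow_succ, mul_right_comm] at h3
      rw [hR, div_lt_iff₀ hε] at hx
      by_contra! hlt
      nlinarith [mul_lt_mul_of_pos_right hlt hx0]
    calc ‖x‖ ^ k * ‖iteratedFDeriv ℝ i f x - iteratedFDeriv ℝ i g x‖
        ≤ ‖x‖ ^ k * (‖iteratedFDeriv ℝ i f x‖ + ‖iteratedFDeriv ℝ i g x‖) := by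
          gcongr; exact norm_sub_le _ _
      _ ≤ ε / 2 := by rw [mul_add]; linarith [e f hf.1, e g hg.1]

end Schwartz

/-! ### Smooth functions vanishing outside a compact set -/

section SupportedIn

open SchwartzMap ContDiffMapSupportedIn
open scoped Distributions

variable {E F : Type*} [NormedAddCommGroup E] [NormedSpace ℝ E] [NormedAddCommGroup F]
  [NormedSpace ℝ F] {K : TopologicalSpace.Compacts E}
  (𝕜 : Type*) [NontriviallyNormedField 𝕜] [NormedSpace 𝕜 F] [SMulCommClass ℝ 𝕜 F]

theorem exists_seminorm_toSchwartzMap_le (K : TopologicalSpace.Compacts E) (k i : ℕ) :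
    ∃ C : NNReal, ∀ f : 𝓓_{K}(E, F), SchwartzMap.seminorm 𝕜 k i
      (f.hasCompactSupport.toSchwartzMap f.contDiff) ≤ C * N[𝕜]_{K, i} f := by
  obtain ⟨R, hR⟩ := K.isCompact.isBounded.exists_norm_le
  refine ⟨(|R| ^ k).toNNReal, fun f => ?_⟩
  rw [Real.coe_toNNReal _ (by positivity)]
  refine SchwartzMap.seminorm_le_bound 𝕜 k i _ (by positivity) fun x => ?_
  change ‖x‖ ^ k * ‖iteratedFDeriv ℝ i f x‖ ≤ _
  by_cases hx : x ∈ K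
  · gcongr
    · exact (hR x hx).trans (le_abs_self R)
    · exact norm_iteratedFDeriv_apply_le_seminorm_top 𝕜
  · rw [f.iteratedFDeriv_zero_on_compl hx]
    simp only [Pi.zero_apply, norm_zero, mul_zero]
    positivity

/-- The inclusion of the smooth functions vanishing outside `K` into the Schwartz space. -/
noncomputable def supportedInToSchwartz : 𝓓_{K}(E, F) →L[𝕜] 𝓢(E, F) where
  toFun f := f.hasCompactSupport.toSchwartzMap f.contDiff
  map_add' _ _ := rfl
  map_smul' _ _ := rfl
  cont := by
    let Φ : 𝓓_{K}(E, F) →ₗ[𝕜] 𝓢(E, F) :=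
      { toFun := fun f => f.hasCompactSupport.toSchwartzMap f.contDiff
        map_add' := fun _ _ => rfl
        map_smul' := fun _ _ => rfl }
    change Continuous Φ
    refine WithSeminorms.continuous_of_isBounded (ContDiffMapSupportedIn.withSeminorms 𝕜 E F ⊤ K)
      (schwartz_withSeminorms 𝕜 E F) Φ fun ⟨k, i⟩ => ?_
    obtain ⟨C, hC⟩ := exists_seminorm_toSchwartzMap_le (F := F) 𝕜 K k i
    exact ⟨{i}, C, fun f => by simpa using! hC f⟩

theorem isUniformInducing_supportedInToSchwartz :
    IsUniformInducing (supportedInToSchwartz 𝕜 : 𝓓_{K}(E, F) →L[𝕜] 𝓢(E, F)) := by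
  set ι := (supportedInToSchwartz 𝕜 : 𝓓_{K}(E, F) →L[𝕜] 𝓢(E, F))
  refine AddMonoidHom.isUniformInducing_of_isInducing (f := ι)
    ((IsTopologicalAddGroup.isInducing_iff_nhds_zero).2 (le_antisymm ?_ ?_))
  · exact (ι.continuous.tendsto' 0 0 (map_zero ι)).le_comap
  · rw [(SeminormFamily.withSeminorms_iff_nhds_eq_iInf _).1
      (ContDiffMapSupportedIn.withSeminorms 𝕜 E F ⊤ K), le_iInf_iff]
    intro i
    rw [← tendsto_iff_comap]
    have h : Tendsto (fun f : 𝓓_{K}(E, F) => SchwartzMap.seminorm 𝕜 0 i (ι f))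
        (comap ι (𝓝 0)) (𝓝 0) := by
      have hc : Continuous (SchwartzMap.seminorm 𝕜 0 i : 𝓢(E, F) → ℝ) :=
        (schwartz_withSeminorms 𝕜 E F).continuous_seminorm (0, i)
      exact (hc.tendsto' 0 0 (map_zero _)).comp tendsto_comap
    refine squeeze_zero (fun f => apply_nonneg _ _) (fun f => ?_) h
    refine (ContDiffMapSupportedIn.seminorm_top_le_iff 𝕜 (apply_nonneg _ _) i f).2 fun x _ => ?_
    exact SchwartzMap.norm_iteratedFDeriv_le_seminorm 𝕜 (ι f) i x

theorem range_supportedInToSchwartz :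
    range (supportedInToSchwartz 𝕜 : 𝓓_{K}(E, F) →L[𝕜] 𝓢(E, F)) =
      {f : 𝓢(E, F) | ∀ x ∉ K, f x = 0} := by
  refine Subset.antisymm ?_ fun f hf => ?_
  · rintro _ ⟨f, rfl⟩ x hx
    exact f.zero_on_compl hx
  · exact ⟨⟨f, f.smooth ⊤, fun x hx => hf x hx⟩, rfl⟩

instance completeSpace_supportedIn [CompleteSpace F] : CompleteSpace 𝓓_{K}(E, F) := by
  rw [completeSpace_iff_isComplete_range (isUniformInducing_supportedInToSchwartz ℝ)]
  refine IsClosed.isComplete ?_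
  rw [range_supportedInToSchwartz]
  simp only [ofPred_forall]
  refine isClosed_iInter fun x => isClosed_iInter fun _ => isClosed_eq ?_ continuous_const
  exact ((continuous_eval_const (F := BoundedContinuousFunction E F) x).comp
    (SchwartzMap.toBoundedContinuousFunctionCLM ℝ E F).continuous :)

theorem baireSpace_supportedIn [CompleteSpace F] : BaireSpace 𝓓_{K}(E, F) := by
  have := (ContDiffMapSupportedIn.withSeminorms ℝ E F ⊤ K).firstCountableTopology
  have := IsUniformAddGroup.uniformity_countably_generated (α := 𝓓_{K}(E, F))
  let := UniformSpace.pseudoMetricSpace 𝓓_{K}(E, F)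
  infer_instance

/-- The Montel property of the space of smooth functions vanishing outside `K`. -/
theorem totallyBounded_of_isVonNBounded_supportedIn [FiniteDimensional ℝ E]
    [FiniteDimensional ℝ F] {B : Set 𝓓_{K}(E, F)} (hB : Bornology.IsVonNBounded 𝕜 B) :
    TotallyBounded B :=
  (totallyBounded_image_iff (isUniformInducing_supportedInToSchwartz 𝕜)).1
    (totallyBounded_of_isVonNBounded_schwartzMap (hB.image (supportedInToSchwartz 𝕜)))

end SupportedIn

/-! ### Test functions and their inductive limit topology -/

section TestFunctions

open TestFunction ContDiffMapSupportedIn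
open scoped Distributions

variable {E F : Type*} [NormedAddCommGroup E] [NormedSpace ℝ E] [NormedAddCommGroup F]
  [NormedSpace ℝ F] {Ω : TopologicalSpace.Opens E}

theorem exists_ofSupportedIn_eq {K : TopologicalSpace.Compacts E} (hK : (K : Set E) ⊆ Ω)
    (f : 𝓓(Ω, F)) (hf : ∀ x ∉ K, f x = 0) : ∃ u : 𝓓_{K}(E, F), ofSupportedIn hK u = f :=
  ⟨⟨f, f.contDiff, fun x hx => hf x hx⟩, rfl⟩

/-- A seminorm on the space of test functions is continuous as soon as its restrictions to the
spaces `𝓓_K` are: the topology it defines is then one of those whose infimum defines the inductive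
limit topology. -/
theorem continuous_seminorm_testFunction (p : Seminorm ℝ 𝓓(Ω, F))
    (h : ∀ (K : TopologicalSpace.Compacts E) (hK : (K : Set E) ⊆ Ω),
      Continuous fun u : 𝓓_{K}(E, F) => p (ofSupportedIn hK u)) : Continuous p := by
  let P : SeminormFamily ℝ 𝓓(Ω, F) Unit := fun _ => p
  let t : TopologicalSpace 𝓓(Ω, F) := P.moduleFilterBasis.topology
  have ht : @WithSeminorms _ _ _ _ _ _ P t := @WithSeminorms.mk _ _ _ _ _ _ _ t rfl
  have := ht.topologicalAddGroup
  have := ht.continuousSMul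
  have := ht.toLocallyConvexSpace
  have hle : TestFunction.topologicalSpace Ω F ⊤ ≤ t := by
    rw [topologicalSpace_le_iff]
    refine iSup₂_le fun K hK => ?_
    rw [← continuous_iff_coinduced_le]
    let T : 𝓓_{K}(E, F) →ₗ[ℝ] 𝓓(Ω, F) :=
      { toFun := ofSupportedIn hK
        map_add' := fun _ _ => rfl
        map_smul' := fun _ _ => rfl }
    exact WithSeminorms.continuous_of_continuous_comp ht T fun _ => h K hK
  have hpt : @Continuous _ _ t _ p := ht.continuous_seminorm ()
  exact continuous_le_dom hle hpt

/-- In the inductive limit topology, a convex set is a neighborhood of `0` as soon as its traces on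
the spaces `𝓓_K` are. -/
theorem convex_mem_nhds_zero {V : Set 𝓓(Ω, F)} (hV : Convex ℝ V)
    (h : ∀ (K : TopologicalSpace.Compacts E) (hK : (K : Set E) ⊆ Ω),
      (ofSupportedIn hK : 𝓓_{K}(E, F) → 𝓓(Ω, F)) ⁻¹' V ∈ 𝓝 0) : V ∈ 𝓝 (0 : 𝓓(Ω, F)) := by
  -- the gauge of the symmetric set `S = V ∩ -V` is a continuous seminorm
  set S := V ∩ -V
  have hSc : Convex ℝ S := hV.inter hV.neg
  have hSn : ∀ (K : TopologicalSpace.Compacts E) (hK : (K : Set E) ⊆ Ω),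
      (ofSupportedInCLM ℝ hK : 𝓓_{K}(E, F) →L[ℝ] 𝓓(Ω, F)) ⁻¹' S ∈ 𝓝 0 := by
    intro K hK
    refine inter_mem (h K hK) ?_
    have := neg_mem_nhds_zero _ (h K hK)
    exact this
  have hSa : Absorbent ℝ S := by
    intro f
    obtain ⟨u, hu⟩ := exists_ofSupportedIn_eq (K := ⟨tsupport f, f.hasCompactSupport⟩)
      f.tsupport_subset f (fun x hx => image_eq_zero_of_notMem_tsupport hx)
    filter_upwards [absorbent_nhds_zero (𝕜 := ℝ) (hSn _ f.tsupport_subset) u] with c hc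
    obtain ⟨v, hv, hvu⟩ := singleton_subset_iff.1 hc
    refine singleton_subset_iff.2 ⟨_, hv, ?_⟩
    refine Eq.trans ?_ hu
    rw [← hvu]
    rfl
  have hS0 : (0 : 𝓓(Ω, F)) ∈ S := hSa.zero_mem
  have hSb : Balanced ℝ S :=
    (balanced_iff_neg_mem hSc).2 fun f hf => ⟨hf.2, by simpa using hf.1⟩
  let p : Seminorm ℝ 𝓓(Ω, F) := gaugeSeminorm hSb hSc hSa
  have hpS : p.ball 0 1 ⊆ S := fun f hf => by
    rw [Seminorm.mem_ball_zero] at hf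
    exact setOfPred_gauge_lt_one_subset_self hSc hS0 hSa hf
  have hpc : Continuous p := continuous_seminorm_testFunction p fun K hK => by
    refine Seminorm.continuous' (r := 1)
      (p := p.comp (ofSupportedInCLM ℝ hK : 𝓓_{K}(E, F) →L[ℝ] 𝓓(Ω, F)).toLinearMap)
      (mem_of_superset (hSn K hK) fun u hu => ?_)
    rw [Seminorm.mem_closedBall_zero]
    exact gauge_le_one_of_mem hu
  exact mem_of_superset ((Seminorm.continuous_iff one_pos).1 hpc) (hpS.trans inter_subset_left)

/-- Bounded sets of test functions on the whole space are supported in a common ball. Otherwise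
there are `f j` in the set and points `x j` tending to infinity with `f j (x j) ≠ 0`, and the
neighborhood of `0` defined by `‖g (x j)‖ ≤ ‖f j (x j)‖ / (j + 1)` does not absorb the `f j`. -/
theorem exists_forall_notMem_closedBall_eq_zero_of_isVonNBounded
    {𝕜 : Type*} [NontriviallyNormedField 𝕜] [NormedSpace 𝕜 F] [SMulCommClass ℝ 𝕜 F]
    {B : Set 𝓓((⊤ : TopologicalSpace.Opens E), F)} (hB : Bornology.IsVonNBounded 𝕜 B) :
    ∃ R : ℝ, ∀ f ∈ B, ∀ x ∉ Metric.closedBall (0 : E) R, f x = 0 := by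
  by_contra! hcon
  choose f hfB x hxR hfx using fun j : ℕ => hcon j
  let V : Set 𝓓((⊤ : TopologicalSpace.Opens E), F) :=
    {g | ∀ j : ℕ, ‖g (x j)‖ ≤ ‖f j (x j)‖ / (j + 1)}
  have hV : V ∈ 𝓝 0 := by
    refine convex_mem_nhds_zero ?_ fun K hK => ?_
    · intro g hg h hh a b ha hb hab j
      calc ‖(a • g + b • h) (x j)‖ ≤ ‖a • g (x j)‖ + ‖b • h (x j)‖ := norm_add_le _ _
        _ ≤ a * (‖f j (x j)‖ / (j + 1)) + b * (‖f j (x j)‖ / (j + 1)) := by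
            rw [norm_smul, norm_smul, Real.norm_of_nonneg ha, Real.norm_of_nonneg hb]
            gcongr
            exacts [hg j, hh j]
        _ = ‖f j (x j)‖ / (j + 1) := by rw [← add_mul, hab, one_mul]
    · -- only finitely many of the points `x j` lie in `K`
      obtain ⟨R, hR⟩ := K.isCompact.isBounded.exists_norm_le
      obtain ⟨N, hN⟩ := exists_nat_ge R
      have hev : ∀ᶠ u : 𝓓_{K}(E, F) in 𝓝 0, ∀ j ∈ Finset.range N,
          ‖u (x j)‖ < ‖f j (x j)‖ / (j + 1) := by
        rw [Finset.eventually_all]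
        intro j _
        have hc : Continuous fun u : 𝓓_{K}(E, F) => ‖u (x j)‖ := by fun_prop
        refine (hc.tendsto 0).eventually_lt_const ?_
        have := norm_pos_iff.2 (hfx j)
        simpa using by positivity
      filter_upwards [hev] with u hu j
      by_cases hj : j < N
      · exact (hu j (Finset.mem_range.2 hj)).le
      · have hxK : x j ∉ K := fun hK' => hxR j <| mem_closedBall_zero_iff.2 <|
          ((hR _ hK').trans hN).trans (by exact_mod_cast not_lt.1 hj)
        have h0 : u (x j) = 0 := u.zero_on_compl hxK
        change ‖u (x j)‖ ≤ _
        rw [h0, norm_zero]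
        positivity
  obtain ⟨c, hc, -⟩ := ((hB hV).and (Bornology.eventually_ne_cobounded 0)).exists
  obtain ⟨j, hj⟩ := exists_nat_ge ‖c‖
  obtain ⟨g, hg, hgf⟩ := hc (hfB j)
  have h1 : f j (x j) = c • g (x j) := by rw [← hgf]; rfl
  have hpos := norm_pos_iff.2 (hfx j)
  have h2 : ‖f j (x j)‖ ≤ ‖c‖ * (‖f j (x j)‖ / (j + 1)) :=
    calc ‖f j (x j)‖ = ‖c‖ * ‖g (x j)‖ := by rw [← norm_smul, ← h1]
      _ ≤ _ := by gcongr; exact hg j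
  have h3 : ‖c‖ * (‖f j (x j)‖ / (j + 1)) < ‖f j (x j)‖ := by
    rw [mul_div_assoc', div_lt_iff₀ (by positivity)]
    nlinarith
  exact absurd h2 (not_le.2 h3)

section Complex

variable [NormedSpace ℂ F]

/-- The inclusion of test functions into the Schwartz space. -/
noncomputable def testFunctionToSchwartz : 𝓓(Ω, F) →L[ℂ] SchwartzMap E F :=
  TestFunction.limitCLM ℂ (fun f => f.hasCompactSupport.toSchwartzMap f.contDiff)
    (fun _ _ => supportedInToSchwartz ℂ) fun _ _ _ => rfl

/-- The Montel property of the space of test functions: by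
`exists_forall_notMem_closedBall_eq_zero_of_isVonNBounded` a bounded set comes from some `𝓓_K`,
where it is totally bounded because its image in the Schwartz space is. -/
theorem totallyBounded_of_isVonNBounded_testFunction [FiniteDimensional ℝ E]
    [FiniteDimensional ℝ F] {B : Set 𝓓((⊤ : TopologicalSpace.Opens E), F)}
    (hB : Bornology.IsVonNBounded ℂ B) : TotallyBounded B := by
  have : ProperSpace E := FiniteDimensional.proper ℝ E
  obtain ⟨R, hR⟩ := exists_forall_notMem_closedBall_eq_zero_of_isVonNBounded hB
  let K : TopologicalSpace.Compacts E := ⟨Metric.closedBall 0 R, isCompact_closedBall 0 R⟩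
  have hK : (K : Set E) ⊆ (⊤ : TopologicalSpace.Opens E) := fun _ _ => trivial
  let T : 𝓓_{K}(E, F) →L[ℂ] 𝓓((⊤ : TopologicalSpace.Opens E), F) := ofSupportedInCLM ℂ hK
  have hT : TotallyBounded (T ⁻¹' B) := by
    have h := totallyBounded_of_isVonNBounded_schwartzMap (hB.image testFunctionToSchwartz)
    refine (totallyBounded_preimage
      (isUniformInducing_supportedInToSchwartz ℂ (K := K) (F := F)) h).subset fun u hu => ?_
    exact ⟨T u, hu, rfl⟩
  refine (hT.image (uniformContinuous_addMonoidHom_of_continuous T.continuous)).subset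
    fun f hf => ?_
  obtain ⟨u, rfl⟩ := exists_ofSupportedIn_eq hK f (hR f hf)
  exact ⟨u, hf, rfl⟩

instance continuousConstSMul_testFunction : ContinuousConstSMul ℂ 𝓓(Ω, F) where
  continuous_const_smul c :=
    (TestFunction.limitCLM ℂ (fun f => c • f) (fun _ hK => (ofSupportedInCLM ℂ hK).comp (c • ContinuousLinearMap.id ℂ _))
      fun _ _ _ => rfl : 𝓓(Ω, F) →L[ℂ] 𝓓(Ω, F)).continuous

/-- A pointwise bounded sequence of continuous functionals on the space of test functions, each
demi-linear with `r = 1` and `γ t = t`, is bounded by `1`, uniformly in the index, on a neighborhood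
of `0`. Indeed the absolute values of such functionals are convex near `0`, so that it is enough to
check this on each `𝓓_K`, which is a Baire space. -/
theorem exists_nhds_norm_le_one_of_strongDemiLinear [CompleteSpace F] {W : Set 𝓓(Ω, F)}
    (hW : W ∈ 𝓝 0) {f : ℕ → 𝓓(Ω, F) → ℂ} (hf : ∀ k, f k ∈ strongDemiLinear (fun t : ℂ => t) W)
    (hfc : ∀ k, Continuous (f k)) (hb : ∀ x, ∃ C : ℝ, ∀ k, ‖f k x‖ ≤ C) :
    ∃ V ∈ 𝓝 (0 : 𝓓(Ω, F)), ∀ k, ∀ u ∈ V, ‖f k u‖ ≤ 1 := by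
  obtain ⟨W', ⟨hW'0, hW'c⟩, hW'W⟩ :=
    (LocallyConvexSpace.convex_basis_zero ℝ 𝓓(Ω, F)).mem_iff.1 hW
  simp only [id] at hW'W
  have key : ∀ k x, ∀ u ∈ W', ∀ t : ℂ, ‖t‖ ≤ 1 → ‖f k (x + t • u) - f k x‖ ≤ ‖t‖ * ‖f k u‖ :=
    fun k x u hu => (mem_strongDemiLinear_iff.1 (hf k)).2 x u (hW'W hu)
  have hsmul : ∀ k, ∀ u ∈ W', ∀ t : ℂ, ‖t‖ ≤ 1 → ‖f k (t • u)‖ ≤ ‖t‖ * ‖f k u‖ := by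
    intro k u hu t ht
    simpa [(hf k).1] using key k 0 u hu t ht
  refine ⟨{u ∈ W' | ∀ k, ‖f k u‖ ≤ 1}, convex_mem_nhds_zero ?_ fun K hK => ?_,
    fun k u hu => hu.2 k⟩
  · intro u hu v hv a b ha hb hab
    refine ⟨hW'c hu.1 hv.1 ha hb hab, fun k => ?_⟩
    have ha1 : ‖(a : ℂ)‖ ≤ 1 := by rw [Complex.norm_real, Real.norm_of_nonneg ha]; linarith
    have hb1 : ‖(b : ℂ)‖ ≤ 1 := by rw [Complex.norm_real, Real.norm_of_nonneg hb]; linarith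
    have h1 := hsmul k u hu.1 a ha1
    have h2 := key k ((a : ℂ) • u) v hv.1 b hb1
    have h3 := norm_le_insert' (f k ((a : ℂ) • u + (b : ℂ) • v)) (f k ((a : ℂ) • u))
    rw [Complex.norm_real, Real.norm_of_nonneg ha] at h1
    rw [Complex.norm_real, Real.norm_of_nonneg hb] at h2
    rw [← algebraMap_smul ℂ a u, ← algebraMap_smul ℂ b v]
    change ‖f k ((a : ℂ) • u + (b : ℂ) • v)‖ ≤ 1
    nlinarith [hu.2 k, hv.2 k]
  · let T : 𝓓_{K}(E, F) →L[ℂ] 𝓓(Ω, F) := ofSupportedInCLM ℂ hK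
    have hT : T ⁻¹' W' ∈ 𝓝 0 := T.continuous.tendsto' 0 0 (map_zero T) hW'0
    have := baireSpace_supportedIn (E := E) (F := F) (K := K)
    obtain ⟨V, hV, M, hM⟩ := exists_nhds_norm_le_of_baire (γ := fun t => t) (U := T ⁻¹' W')
      (f := fun k u => f k (T u)) hT
      (fun k => strongDemiLinear_subset_demiLinear <| mem_strongDemiLinear_iff.2
        ⟨by simp [(hf k).1], fun x u hu t ht => by simpa using key k (T x) (T u) hu t ht⟩)
      (fun k => (hfc k).comp T.continuous) (fun u => hb (T u))
    have hM0 : 0 ≤ M := (norm_nonneg _).trans (hM 0 0 (mem_of_mem_nhds hV))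
    -- shrink `V` by a factor `t` with `|t| * M ≤ 1`
    set t : ℂ := (((M + 1)⁻¹ : ℝ) : ℂ) with ht
    have htn : ‖t‖ = (M + 1)⁻¹ := by
      rw [ht, Complex.norm_real, Real.norm_of_nonneg (by positivity)]
    have ht0 : t ≠ 0 := by rw [← norm_ne_zero_iff, htn]; positivity
    filter_upwards [hT, exists_smul_mem_nhds (inter_mem hV hT) ht0 0]
    rintro _ hu ⟨v, hv, rfl⟩
    refine ⟨hu, fun k => ?_⟩
    have h1 : ‖f k (t • T v)‖ ≤ ‖t‖ * ‖f k (T v)‖ :=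
      hsmul k (T v) hv.2 t (by rw [htn]; exact inv_le_one_of_one_le₀ (by linarith))
    change ‖f k (T (0 + t • v))‖ ≤ 1
    rw [zero_add, map_smul]
    refine h1.trans ?_
    rw [htn, inv_mul_le_one₀ (by positivity)]
    exact (hM k v hv.1).trans (by linarith)

end Complex

end TestFunctions

theorem isSeqComplete_strongDemiDistributions_testSpace (n : ℕ) {W : Set (TestSpace n)}
    (hW : W ∈ 𝓝 0) : IsSeqComplete (strongDemiDistributions (fun t : ℂ => t) W) := by
  intro f hf hcau
  choose g hg using hcau
  have hfs : ∀ k, f k ∈ strongDemiLinear (fun t : ℂ => t) W := fun k => (hf k).2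
  have hfd : ∀ k, f k ∈ demiLinear (fun t : ℂ => t) W :=
    fun k => strongDemiLinear_subset_demiLinear (hfs k)
  have hγ : (fun t : ℂ => t) ∈ C0 := ⟨rfl, tendsto_id, fun _ _ => le_rfl⟩
  obtain ⟨V, hV, hM⟩ := exists_nhds_norm_le_one_of_strongDemiLinear hW hfs (fun k => (hf k).1)
    (exists_norm_le_of_isWeakStarCauchy fun x => ⟨_, hg x⟩)
  exact ⟨g, ⟨continuous_of_tendsto_of_norm_le hγ hW hfd hV hM hg,
    mem_strongDemiLinear_of_tendsto hfs hg⟩, fun B hB =>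
    tendstoUniformlyOn_of_norm_le hγ hW hfd hV hM hg
      (totallyBounded_of_isVonNBounded_testFunction hB)⟩

end DemiDist

theorem theorem1p8 (n : ℕ) :
    (∀ a : ℝ, 0 < a → ∀ γ ∈ DemiDist.C0, ∀ U ∈ 𝓝 (0 : DemiDist.TestBall n a),
      DemiDist.IsSeqComplete (DemiDist.demiDistributions γ U)) ∧
    (∀ γ ∈ DemiDist.C0, ∀ V ∈ 𝓝 (0 : DemiDist.RapidSpace n),
      DemiDist.IsSeqComplete (DemiDist.demiDistributions γ V)) ∧
    (∀ W ∈ 𝓝 (0 : DemiDist.TestSpace n),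
      DemiDist.IsSeqComplete (DemiDist.strongDemiDistributions (fun t : ℂ => t) W)) := by
  refine ⟨fun a _ γ hγ U hU => ?_, fun γ hγ V hV => ?_, fun W hW =>
    DemiDist.isSeqComplete_strongDemiDistributions_testSpace n hW⟩
  · have : BaireSpace (DemiDist.TestBall n a) := DemiDist.baireSpace_supportedIn
    exact DemiDist.isSeqComplete_demiDistributions
      (fun B hB => DemiDist.totallyBounded_of_isVonNBounded_supportedIn ℂ hB) hγ hU
  · have : BaireSpace (DemiDist.RapidSpace n) := DemiDist.baireSpace_schwartzMap
    exact DemiDist.isSeqComplete_demiDistributions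
      (fun B hB => DemiDist.totallyBounded_of_isVonNBounded_schwartzMap hB) hγ hV
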